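/- Let $P$ be a finite set of primes, let $k\ge 1$ be an integer, and let $\mathcal A_P$ be the set of isomorphism classes of finite abelian groups $G$ such that every prime factor of $|G|$ lies in $P$. For a finite abelian group $G$, let $n_k(G)$ be the number of sequences of nested subgroups $0=H_0\le H_1\le\dots\le H_{k-1}\le H_k=G$, and let $(a;q)_\infty=\prod_{i\ge 0}(1-aq^i)$. For finite abelian groups $B,G$, let $\mathrm{Sur}(B,G)$ be the set of surjective group homomorphisms $B\to G$ and $\mathrm{Aut}(B)$ the group of automorphisms of $B$. Then $$\mathbb P_P^{*(k)}(B):=\Big(\prod_{p\in P}(p^{-1};p^{-1})_\infty^k\Big)\frac{n_k(B)}{\#\mathrm{Aut}(B)},\qquad B\in\mathcal A_P,$$ defines a probability measure on $\mathcal A_P$, and for every $G\in\mathcal A_P$ the $\mathrm{Sur}$-moment of this measure is finite and equals $$\mathbb E_{B\sim\mathbb P_P^{*(k)}}[\#\mathrm{Sur}(B,G)]=n_k(G).$$ -/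

import Mathlib

open MeasureTheory

/-- `G` is a finite abelian group such that every prime factor of `|G|` lies in `P`. -/
def IsAbelianPGroup (P : Finset ℕ) (G : Type*) [AddCommGroup G] : Prop :=
  Finite G ∧ ∀ p : ℕ, p.Prime → p ∣ Nat.card G → p ∈ P

/-- `#Sur(B, G)`, the number of surjective homomorphisms from `B` to `G`. -/
noncomputable def surCount (B G : Type*) [AddCommGroup B] [AddCommGroup G] : ℕ :=
  Nat.card {f : B →+ G // Function.Surjective f}

/-- `#Aut(B)`. -/
noncomputable def autCount (B : Type*) [AddCommGroup B] : ℕ :=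
  Nat.card (B ≃+ B)

/-- `n_k(G)`, the number of chains of subgroups `0 = H_0 ≤ H_1 ≤ ⋯ ≤ H_k = G`. -/
noncomputable def chainCount (k : ℕ) (G : Type*) [AddCommGroup G] : ℕ :=
  Nat.card {H : Fin (k + 1) → AddSubgroup G //
    Monotone H ∧ H 0 = ⊥ ∧ H (Fin.last k) = ⊤}

/-- The infinite `q`-Pochhammer symbol `(a; q)_∞ = ∏_{i ≥ 0} (1 - a q ^ i)`. -/
noncomputable def qPochhammerInf (a q : ℝ) : ℝ :=
  ∏' i : ℕ, (1 - a * q ^ i)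

/-- The product defining `(a; q)_∞` converges whenever `|q| < 1`. -/
theorem multipliable_qPochhammerInf (a q : ℝ) (hq : |q| < 1) :
    Multipliable fun i : ℕ => 1 - a * q ^ i := by
  have h : Summable fun i : ℕ => -(a * q ^ i) :=
    ((summable_geometric_of_abs_lt_one hq).mul_left a).neg
  simpa [sub_eq_add_neg] using Real.multipliable_one_add_of_summable h

/-- The weight `∏_{p ∈ P} (p⁻¹; p⁻¹)_∞ ^ k * n_k(B) / #Aut(B)`. -/
noncomputable def prodWeight (P : Finset ℕ) (k : ℕ) (B : Type*) [AddCommGroup B] : ℝ :=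
  (∏ p ∈ P, qPochhammerInf (p : ℝ)⁻¹ (p : ℝ)⁻¹ ^ k) * (chainCount k B : ℝ) / (autCount B : ℝ)

theorem surCount_congr {B B' : Type*} (G : Type*) [AddCommGroup B] [AddCommGroup B']
    [AddCommGroup G] (e : B ≃+ B') : surCount B G = surCount B' G := by
  refine Nat.card_congr
    { toFun := fun f => ⟨f.1.comp e.symm.toAddMonoidHom, f.2.comp e.symm.surjective⟩
      invFun := fun f => ⟨f.1.comp e.toAddMonoidHom, f.2.comp e.surjective⟩
      left_inv := ?_
      right_inv := ?_ }
  · intro f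
    ext x
    simp
  · intro f
    ext x
    simp

theorem autCount_congr {B B' : Type*} [AddCommGroup B] [AddCommGroup B'] (e : B ≃+ B') :
    autCount B = autCount B' := by
  refine Nat.card_congr
    { toFun := fun f => (e.symm.trans f).trans e
      invFun := fun f => (e.trans f).trans e.symm
      left_inv := ?_
      right_inv := ?_ }
  · intro f
    ext x
    simp
  · intro f
    ext x
    simp

theorem chainCount_congr (k : ℕ) {B B' : Type*} [AddCommGroup B] [AddCommGroup B']
    (e : B ≃+ B') : chainCount k B = chainCount k B' := by
  let E : AddSubgroup B ≃o AddSubgroup B' := e.mapAddSubgroup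
  refine Nat.card_congr
    { toFun := fun H => ⟨fun i => E (H.1 i), fun i j h => E.monotone (H.2.1 h),
        by simp [H.2.2.1], by simp [H.2.2.2]⟩
      invFun := fun H => ⟨fun i => E.symm (H.1 i), fun i j h => E.symm.monotone (H.2.1 h),
        by simp [H.2.2.1], by simp [H.2.2.2]⟩
      left_inv := ?_
      right_inv := ?_ }
  · intro H
    apply Subtype.ext
    funext i
    simp
  · intro H
    apply Subtype.ext
    funext i
    simp

theorem prodWeight_congr (P : Finset ℕ) (k : ℕ) {B B' : Type*} [AddCommGroup B]
    [AddCommGroup B'] (e : B ≃+ B') : prodWeight P k B = prodWeight P k B' := by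
  simp only [prodWeight, chainCount_congr k e, autCount_congr e]

/-- A finite abelian group such that every prime factor of its order lies in `P`, bundled. -/
structure AbelianPGroup (P : Finset ℕ) : Type 1 where
  carrier : Type
  [group : AddCommGroup carrier]
  isAbelianPGroup : IsAbelianPGroup P carrier

attribute [instance] AbelianPGroup.group

/-- Isomorphism of groups, as an equivalence relation. -/
instance AbelianPGroup.setoid (P : Finset ℕ) : Setoid (AbelianPGroup P) where
  r B B' := Nonempty (B.carrier ≃+ B'.carrier)
  iseqv :=
    { refl := fun B => ⟨AddEquiv.refl B.carrier⟩
      symm := fun ⟨e⟩ => ⟨e.symm⟩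
      trans := fun ⟨e⟩ ⟨e'⟩ => ⟨e.trans e'⟩ }

/-- The set `𝒜_P` of isomorphism classes of finite abelian groups all of whose orders' prime
factors lie in `P`. -/
def AbelianPClass (P : Finset ℕ) : Type 1 :=
  Quotient (AbelianPGroup.setoid P)

/-- Every set of isomorphism classes is measurable. -/
instance AbelianPClass.measurableSpace (P : Finset ℕ) : MeasurableSpace (AbelianPClass P) := ⊤

/-- The weight of an isomorphism class. -/
noncomputable def AbelianPClass.weight {P : Finset ℕ} (k : ℕ) (B : AbelianPClass P) : ℝ :=
  Quotient.lift (fun B : AbelianPGroup P => prodWeight P k B.carrier)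
    (fun B B' (h : Nonempty (B.carrier ≃+ B'.carrier)) => h.elim (prodWeight_congr P k)) B

/-- `#Sur(B, G)` as a function of the isomorphism class of `B`. -/
noncomputable def AbelianPClass.sur {P : Finset ℕ} (G : Type*) [AddCommGroup G]
    (B : AbelianPClass P) : ℕ :=
  Quotient.lift (fun B : AbelianPGroup P => surCount B.carrier G)
    (fun B B' (h : Nonempty (B.carrier ≃+ B'.carrier)) => h.elim (surCount_congr G)) B

/-! Everything is computed on quotients of `ℤ ^ n`, and `n` is then sent to infinity. Give a
subgroup `L` of `ℤ ^ n` with `P`-smooth index the weight `[ℤ ^ n : L] ^ (-n)`, and let `ζ_n` be the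
total weight. Building up one coordinate at a time (`subgroupZeta_prod_int`) and the Euler product
give `ζ_n = ∏_{p ∈ P} ∏_{j=1}^{n} (1 - p ^ (-j))⁻¹`. The subgroups with quotient isomorphic to `B`
number `#Sur(ℤ ^ n, B) / #Aut(B)`, so their total weight is `1 / #Aut(B)` times the probability
`genProb` that `n` random elements generate `B`.

The key is self-similarity. A finite-index `M ≤ ℤ ^ n` is again isomorphic to `ℤ ^ n`, so the
subgroups of `M` have total weight `ζ_n` times the weight of `M`. Given `φ : ℤ ^ n → G`, Möbius
uniqueness on the subgroups of `φ(M)` then shows that a random `L ≤ M` has the same image law as the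
subgroup generated by `n` random elements of `φ(M)` (`mapZeta_mul_pow`).

Summing `n_k(ℤ ^ n / L) * #Sur(ℤ ^ n / L, G)` over `L` counts chains `L = L_0 ≤ ⋯ ≤ L_k = ℤ ^ n`
together with surjections `φ` killing `L`. Peeling off one step at a time replaces such a chain by
the chain of its images in `G`, at the cost of a factor `ζ_n` and a factor `genProb` per step
(`kerChainZeta_mul_pow`). As `n → ∞` every `genProb` tends to `1` and `ζ_n` tends to `∏ (p⁻¹;
p⁻¹)_∞⁻¹`, which gives the moment. The case `G = 0` says that the total mass is `1`. -/

open scoped ENNReal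

/-! ### Multiplicative weights on `P`-smooth numbers -/

/-- The weight `m ^ (-s)` on naturals with all prime factors in `P`, extended by zero. -/
noncomputable def smoothWeight (P : Finset ℕ) (s m : ℕ) : ℝ≥0∞ :=
  if m ∈ Nat.factoredNumbers P then ((m : ℝ≥0∞)⁻¹) ^ s else 0

theorem smoothWeight_of_mem {P : Finset ℕ} (s : ℕ) {m : ℕ} (h : m ∈ Nat.factoredNumbers P) :
    smoothWeight P s m = ((m : ℝ≥0∞)⁻¹) ^ s := if_pos h

theorem smoothWeight_of_notMem {P : Finset ℕ} (s : ℕ) {m : ℕ} (h : m ∉ Nat.factoredNumbers P) :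
    smoothWeight P s m = 0 := if_neg h

@[simp]
theorem smoothWeight_zero (P : Finset ℕ) (s : ℕ) : smoothWeight P s 0 = 0 :=
  smoothWeight_of_notMem s fun h => h.1 rfl

theorem one_mem_factoredNumbers (P : Finset ℕ) : 1 ∈ Nat.factoredNumbers P := by
  simp [Nat.mem_factoredNumbers]

@[simp]
theorem smoothWeight_one (P : Finset ℕ) (s : ℕ) : smoothWeight P s 1 = 1 := by
  simp [smoothWeight_of_mem s (one_mem_factoredNumbers P)]

theorem smoothWeight_mul (P : Finset ℕ) (s a b : ℕ) :
    smoothWeight P s (a * b) = smoothWeight P s a * smoothWeight P s b := by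
  by_cases ha : a ∈ Nat.factoredNumbers P
  · by_cases hb : b ∈ Nat.factoredNumbers P
    · rw [smoothWeight_of_mem s ha, smoothWeight_of_mem s hb,
        smoothWeight_of_mem s (Nat.mul_mem_factoredNumbers ha hb), ← mul_pow, Nat.cast_mul,
        ENNReal.mul_inv (by simp) (by simp)]
    · rw [smoothWeight_of_notMem s hb, mul_zero]
      exact smoothWeight_of_notMem s fun h => hb (Nat.mem_factoredNumbers_of_dvd h ⟨a, mul_comm _ _⟩)
  · rw [smoothWeight_of_notMem s ha, zero_mul]
    exact smoothWeight_of_notMem s fun h => ha (Nat.mem_factoredNumbers_of_dvd h ⟨b, rfl⟩)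

theorem smoothWeight_ne_top (P : Finset ℕ) (s m : ℕ) : smoothWeight P s m ≠ ∞ := by
  by_cases h : m ∈ Nat.factoredNumbers P
  · rw [smoothWeight_of_mem s h]
    exact ENNReal.pow_ne_top (by simpa using h.1)
  · simp [smoothWeight_of_notMem s h]

/-- Summing over the `m` cosets of a subgroup of index `m` lowers the exponent by one. -/
theorem smoothWeight_succ_mul (P : Finset ℕ) (s m : ℕ) :
    smoothWeight P (s + 1) m * m = smoothWeight P s m := by
  by_cases h : m ∈ Nat.factoredNumbers P
  · rw [smoothWeight_of_mem _ h, smoothWeight_of_mem _ h, pow_succ, mul_assoc,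
      ENNReal.inv_mul_cancel (by simpa using h.1) (by simp), mul_one]
  · simp [smoothWeight_of_notMem _ h]

/-! ### The subgroup zeta function of `ℤ ^ n` -/

/-- The sum of `[A : L] ^ (-s)` over subgroups `L` of `A` whose index has its prime factors
in `P`. -/
noncomputable def subgroupZeta (P : Finset ℕ) (s : ℕ) (A : Type*) [AddCommGroup A] : ℝ≥0∞ :=
  ∑' L : AddSubgroup A, smoothWeight P s L.index

theorem subgroupZeta_congr (P : Finset ℕ) (s : ℕ) {A B : Type*} [AddCommGroup A] [AddCommGroup B]
    (e : A ≃+ B) : subgroupZeta P s A = subgroupZeta P s B := by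
  unfold subgroupZeta
  rw [← e.mapAddSubgroup.toEquiv.tsum_eq]
  refine tsum_congr fun L => ?_
  congr 1
  exact (AddSubgroup.index_map_equiv L e).symm

/-- The subgroup of `A × ℤ` generated by `L × 0` and a lift of `(q, d)`. -/
def extendSubgroup {A : Type*} [AddCommGroup A] (L : AddSubgroup A) (d : ℤ) (q : A ⧸ L) :
    AddSubgroup (A × ℤ) :=
  (AddSubgroup.zmultiples (q, d)).comap ((QuotientAddGroup.mk' L).prodMap (AddMonoidHom.id ℤ))

theorem mem_extendSubgroup {A : Type*} [AddCommGroup A] {L : AddSubgroup A} {d : ℤ} {q : A ⧸ L}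
    {x : A × ℤ} : x ∈ extendSubgroup L d q ↔ ∃ t : ℤ, t • q = (x.1 : A ⧸ L) ∧ t * d = x.2 := by
  simp [extendSubgroup, AddSubgroup.mem_zmultiples_iff, Prod.ext_iff]

theorem comap_inl_extendSubgroup {A : Type*} [AddCommGroup A] (L : AddSubgroup A) {d : ℤ}
    (hd : d ≠ 0) (q : A ⧸ L) :
    (extendSubgroup L d q).comap (AddMonoidHom.inl A ℤ) = L := by
  ext x
  simp only [AddSubgroup.mem_comap, AddMonoidHom.inl_apply, mem_extendSubgroup, mul_eq_zero, hd,
    or_false]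
  rw [← QuotientAddGroup.eq_zero_iff]
  constructor
  · rintro ⟨t, h, rfl⟩
    simpa using h.symm
  · exact fun h => ⟨0, by simpa using h.symm, rfl⟩

theorem map_snd_extendSubgroup {A : Type*} [AddCommGroup A] (L : AddSubgroup A) (d : ℤ)
    (q : A ⧸ L) :
    (extendSubgroup L d q).map (AddMonoidHom.snd A ℤ) = AddSubgroup.zmultiples d := by
  ext x
  simp only [AddSubgroup.mem_map, mem_extendSubgroup, AddMonoidHom.coe_snd,
    AddSubgroup.mem_zmultiples_iff, smul_eq_mul]
  constructor
  · rintro ⟨y, ⟨t, -, h⟩, rfl⟩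
    exact ⟨t, h⟩
  · rintro ⟨t, rfl⟩
    obtain ⟨y, hy⟩ := QuotientAddGroup.mk_surjective (t • q)
    exact ⟨(y, t * d), ⟨t, hy.symm, rfl⟩, rfl⟩

/-- Split the index at `L ⊔ ker snd`: the lower part is the index of `L ∩ A` in `A`, the upper part
that of the projection in `B`. -/
theorem index_prod_eq {A B : Type*} [AddCommGroup A] [AddCommGroup B] (L : AddSubgroup (A × B)) :
    L.index = (L.comap (AddMonoidHom.inl A B)).index * (L.map (AddMonoidHom.snd A B)).index := by
  have hs : Function.Surjective (AddMonoidHom.snd A B) := Prod.snd_surjective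
  rw [← AddSubgroup.index_comap_of_surjective (L.map (AddMonoidHom.snd A B)) hs,
    AddSubgroup.comap_map_eq, AddSubgroup.index_comap,
    ← AddSubgroup.relIndex_mul_index (le_sup_left : L ≤ L ⊔ (AddMonoidHom.snd A B).ker),
    AddSubgroup.relIndex_sup_left]
  congr 2
  ext x
  simp [AddSubgroup.mem_prod, Prod.ext_iff, eq_comm]

theorem index_extendSubgroup {A : Type*} [AddCommGroup A] (L : AddSubgroup A) {d : ℕ}
    (hd : d ≠ 0) (q : A ⧸ L) : (extendSubgroup L d q).index = L.index * d := by
  rw [index_prod_eq, comap_inl_extendSubgroup L (by exact_mod_cast hd), map_snd_extendSubgroup,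
    Int.index_zmultiples, Int.natAbs_natCast]

/-- The parametrization of subgroups of `A × ℤ` with nontrivial projection to `ℤ`. -/
def extendSubgroupSigma (A : Type*) [AddCommGroup A]
    (x : Σ L : AddSubgroup A, {d : ℕ // d ≠ 0} × (A ⧸ L)) : AddSubgroup (A × ℤ) :=
  extendSubgroup x.1 (x.2.1 : ℕ) x.2.2

theorem extendSubgroupSigma_injective (A : Type*) [AddCommGroup A] :
    Function.Injective (extendSubgroupSigma A) := by
  rintro ⟨L, ⟨d, hd⟩, q⟩ ⟨L', ⟨d', hd'⟩, q'⟩ h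
  have hL : L = L' := by
    have := congrArg (AddSubgroup.comap (AddMonoidHom.inl A ℤ)) h
    simpa [extendSubgroupSigma, comap_inl_extendSubgroup, hd, hd'] using this
  have hdd : d = d' := by
    have := congrArg (fun K => (AddSubgroup.map (AddMonoidHom.snd A ℤ) K).index) h
    simpa [extendSubgroupSigma, map_snd_extendSubgroup, Int.index_zmultiples] using this
  subst hL hdd
  obtain ⟨x, rfl⟩ := QuotientAddGroup.mk_surjective q
  have hx : (x, (d : ℤ)) ∈ extendSubgroup L d (x : A ⧸ L) :=
    mem_extendSubgroup.2 ⟨1, by simp, by simp⟩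
  have h' : extendSubgroup L d (x : A ⧸ L) = extendSubgroup L d q' := h
  rw [h', mem_extendSubgroup] at hx
  obtain ⟨t, ht, htd⟩ := hx
  have : t = 1 := by
    have hd0 : (d : ℤ) ≠ 0 := by exact_mod_cast hd
    exact mul_right_cancel₀ hd0 (by simpa using htd)
  subst this
  simp only [one_smul] at ht
  rw [ht]

theorem exists_extendSubgroupSigma_eq {A : Type*} [AddCommGroup A] {K : AddSubgroup (A × ℤ)}
    (hK : K.index ≠ 0) : ∃ x, extendSubgroupSigma A x = K := by
  obtain ⟨a, ha⟩ := Int.subgroup_cyclic (K.map (AddMonoidHom.snd A ℤ))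
  rw [← AddSubgroup.zmultiples_eq_closure, ← Int.zmultiples_natAbs] at ha
  generalize a.natAbs = d at ha
  rw [index_prod_eq, ha, Int.index_zmultiples, Int.natAbs_natCast] at hK
  have hd : d ≠ 0 := right_ne_zero_of_mul hK
  obtain ⟨⟨x, d'⟩, hx, hxd⟩ : (d : ℤ) ∈ K.map (AddMonoidHom.snd A ℤ) := by
    rw [ha]; exact AddSubgroup.mem_zmultiples _
  simp only [AddMonoidHom.coe_snd] at hxd
  subst hxd
  refine ⟨⟨K.comap (AddMonoidHom.inl A ℤ), ⟨d, hd⟩, (x : A ⧸ _)⟩, ?_⟩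
  ext ⟨y, m⟩
  simp only [extendSubgroupSigma, mem_extendSubgroup]
  -- Translating by multiples of the chosen lift of `d` reduces membership in `K` to its
  -- intersection with `A × 0`.
  have key : ∀ t : ℤ, t • (x : A ⧸ K.comap (AddMonoidHom.inl A ℤ)) = (y : A ⧸ _) ↔
      (y - t • x, (0 : ℤ)) ∈ K := by
    intro t
    rw [← QuotientAddGroup.mk_zsmul, QuotientAddGroup.eq, neg_add_eq_sub]
    rfl
  simp only [key]
  constructor
  · rintro ⟨t, h, rfl⟩
    have := K.add_mem h (K.zsmul_mem hx t)
    simpa using this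
  · intro h
    have hm : m ∈ K.map (AddMonoidHom.snd A ℤ) := ⟨_, h, rfl⟩
    rw [ha, AddSubgroup.mem_zmultiples_iff] at hm
    obtain ⟨t, rfl⟩ := hm
    refine ⟨t, ?_, by simp⟩
    have := K.sub_mem h (K.zsmul_mem hx t)
    simpa using this

/-- Over a fixed `L` and `d` lie `[A : L]` subgroups, one for each `q : A ⧸ L`, all of index `[A :
L] * d`. Their number turns the exponent `s + 1` at `L` into `s`. -/
theorem subgroupZeta_prod_int (P : Finset ℕ) (s : ℕ) (A : Type*) [AddCommGroup A] :
    subgroupZeta P (s + 1) (A × ℤ) = subgroupZeta P s A * ∑' d : ℕ, smoothWeight P (s + 1) d := by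
  unfold subgroupZeta
  -- Subgroups missed by the parametrization have infinite index, that is index `0` in Lean, hence
  -- weight `0`.
  have hsupp : Function.support (fun L : AddSubgroup (A × ℤ) => smoothWeight P (s + 1) L.index) ⊆
      Set.range (extendSubgroupSigma A) := by
    intro K hK
    refine exists_extendSubgroupSigma_eq fun h => hK ?_
    simp [h]
  rw [← (extendSubgroupSigma_injective A).tsum_eq hsupp, ENNReal.tsum_sigma',
    ← ENNReal.tsum_mul_right]
  refine tsum_congr fun L => ?_
  rw [ENNReal.tsum_prod', ← smoothWeight_succ_mul]
  have hd : ∑' d : ℕ, smoothWeight P (s + 1) d =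
      ∑' d : {d : ℕ // d ≠ 0}, smoothWeight P (s + 1) d := by
    rw [Subtype.val_injective.tsum_eq (f := fun d : ℕ => smoothWeight P (s + 1) d)]
    intro d hd
    refine ⟨⟨d, ?_⟩, rfl⟩
    rintro rfl
    simp at hd
  rw [hd, ← ENNReal.tsum_mul_left]
  refine tsum_congr fun d => ?_
  have : ∀ q : A ⧸ L, smoothWeight P (s + 1) (extendSubgroupSigma A ⟨L, d, q⟩).index =
      smoothWeight P (s + 1) L.index * smoothWeight P (s + 1) d := by
    intro q
    rw [← smoothWeight_mul, extendSubgroupSigma, index_extendSubgroup L d.2]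
  simp only [this]
  by_cases h : L.index = 0
  · simp [h]
  · have : L.FiniteIndex := ⟨h⟩
    have : Finite (A ⧸ L) := inferInstance
    have : Fintype (A ⧸ L) := Fintype.ofFinite _
    rw [tsum_fintype, Finset.sum_const, nsmul_eq_mul, AddSubgroup.index_eq_card,
      Finset.card_univ, Nat.card_eq_fintype_card]
    ring

/-- `ℤ ^ (n + 1) ≃ ℤ ^ n × ℤ`. -/
def finSuccIntEquiv (n : ℕ) : (Fin (n + 1) → ℤ) ≃+ (Fin n → ℤ) × ℤ where
  toFun x := (fun i => x i.succ, x 0)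
  invFun y := Fin.cons y.2 y.1
  left_inv x := by ext i; refine Fin.cases ?_ (fun i => ?_) i <;> simp
  right_inv y := by simp
  map_add' x y := rfl

theorem subgroupZeta_int_pow_eq_prod (P : Finset ℕ) (n : ℕ) :
    subgroupZeta P n (Fin n → ℤ) =
      ∏ j ∈ Finset.range n, ∑' d : ℕ, smoothWeight P (j + 1) d := by
  induction n with
  | zero =>
    unfold subgroupZeta
    rw [tsum_eq_single ⊤ fun L hL => (hL (Subsingleton.elim _ _)).elim]
    simp
  | succ n ih =>
    rw [subgroupZeta_congr P (n + 1) (finSuccIntEquiv n), subgroupZeta_prod_int, ih,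
      Finset.prod_range_succ]

/-- This is the Euler product restricted to the primes of `P`. -/
theorem tsum_smoothWeight {P : Finset ℕ} (hP : ∀ p ∈ P, p.Prime) (s : ℕ) (hs : s ≠ 0) :
    ∑' d : ℕ, smoothWeight P s d = ENNReal.ofReal (∏ p ∈ P, (1 - ((p : ℝ)⁻¹) ^ s)⁻¹) := by
  let f : ℕ →* ℝ :=
    { toFun := fun m => ((m : ℝ)⁻¹) ^ s
      map_one' := by simp
      map_mul' := fun a b => by push_cast; rw [mul_inv, mul_pow] }
  have hf : ∀ {p : ℕ}, p.Prime → ‖f p‖ < 1 := by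
    intro p hp
    have h1 : (1 : ℝ) < p := by exact_mod_cast hp.one_lt
    have h0 : (0 : ℝ) ≤ (p : ℝ)⁻¹ := by positivity
    change ‖((p : ℝ)⁻¹) ^ s‖ < 1
    rw [Real.norm_of_nonneg (pow_nonneg h0 s)]
    exact pow_lt_one₀ h0 (inv_lt_one_of_one_lt₀ h1) hs
  have h := (EulerProduct.summable_and_hasSum_factoredNumbers_prod_filter_prime_geometric hf P).2
  rw [Finset.filter_true_of_mem hP] at h
  change HasSum _ (∏ p ∈ P, (1 - ((p : ℝ)⁻¹) ^ s)⁻¹) at h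
  rw [← h.tsum_eq, ENNReal.ofReal_tsum_of_nonneg
    (fun m => by change 0 ≤ (((m : ℕ) : ℝ)⁻¹) ^ s; positivity) h.summable]
  have hsupp : Function.support (fun d : ℕ => smoothWeight P s d) ⊆ Nat.factoredNumbers P := by
    intro d hd
    by_contra hc
    exact hd (smoothWeight_of_notMem s hc)
  rw [← tsum_subtype_eq_of_support_subset hsupp]
  refine tsum_congr fun m => ?_
  have hm : (0 : ℝ) < (m : ℕ) := by exact_mod_cast Nat.pos_of_ne_zero m.2.1
  rw [smoothWeight_of_mem s m.2]
  change _ = ENNReal.ofReal (((m : ℕ) : ℝ)⁻¹ ^ s)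
  rw [ENNReal.ofReal_pow (by positivity), ENNReal.ofReal_inv_of_pos hm, ENNReal.ofReal_natCast]

theorem subgroupZeta_int_pow {P : Finset ℕ} (hP : ∀ p ∈ P, p.Prime) (n : ℕ) :
    subgroupZeta P n (Fin n → ℤ) =
      ENNReal.ofReal (∏ p ∈ P, (∏ j ∈ Finset.range n, (1 - (p : ℝ)⁻¹ * ((p : ℝ)⁻¹) ^ j))⁻¹) := by
  have hnn : ∀ p ∈ P, ∀ j : ℕ, 0 ≤ (1 - (p : ℝ)⁻¹ ^ (j + 1))⁻¹ := by
    intro p hp j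
    have h1 : (1 : ℝ) < p := by exact_mod_cast (hP p hp).one_lt
    have : (p : ℝ)⁻¹ ^ (j + 1) ≤ 1 :=
      pow_le_one₀ (by positivity) (inv_le_one_of_one_le₀ h1.le)
    exact inv_nonneg.2 (by linarith)
  rw [subgroupZeta_int_pow_eq_prod]
  simp_rw [← Finset.prod_inv_distrib]
  rw [Finset.prod_comm, ENNReal.ofReal_prod_of_nonneg]
  · refine Finset.prod_congr rfl fun j _ => ?_
    simp_rw [tsum_smoothWeight hP (j + 1) j.succ_ne_zero, pow_succ']
  · intro j _
    refine Finset.prod_nonneg fun p hp => ?_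
    simpa only [pow_succ'] using hnn p hp j

theorem subgroupZeta_int_pow_ne_top {P : Finset ℕ} (hP : ∀ p ∈ P, p.Prime) (n : ℕ) :
    subgroupZeta P n (Fin n → ℤ) ≠ ∞ := by
  rw [subgroupZeta_int_pow hP]
  exact ENNReal.ofReal_ne_top

/-! ### The limit of the zeta values -/

theorem one_sub_inv_mul_pow_pos {p : ℕ} (hp : p.Prime) (j : ℕ) :
    0 < 1 - (p : ℝ)⁻¹ * (p : ℝ)⁻¹ ^ j := by
  have h1 : (1 : ℝ) < p := by exact_mod_cast hp.one_lt
  have : (p : ℝ)⁻¹ ^ (j + 1) < 1 :=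
    pow_lt_one₀ (by positivity) (inv_lt_one_of_one_lt₀ h1) j.succ_ne_zero
  rw [pow_succ'] at this
  linarith

theorem qPochhammerInf_pos {p : ℕ} (hp : p.Prime) :
    0 < qPochhammerInf (p : ℝ)⁻¹ (p : ℝ)⁻¹ := by
  have h1 : (1 : ℝ) < p := by exact_mod_cast hp.one_lt
  have habs : |(p : ℝ)⁻¹| < 1 := by
    rw [abs_of_pos (by positivity)]
    exact inv_lt_one_of_one_lt₀ h1
  have hs : Summable fun i : ℕ => -((p : ℝ)⁻¹ * (p : ℝ)⁻¹ ^ i) :=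
    ((summable_geometric_of_abs_lt_one habs).mul_left _).neg
  have hpos := one_sub_inv_mul_pow_pos hp
  rw [qPochhammerInf, ← Real.rexp_tsum_eq_tprod hpos]
  · exact Real.exp_pos _
  · simpa [sub_eq_add_neg] using Real.summable_log_one_add_of_summable hs

theorem tendsto_subgroupZeta_int_pow {P : Finset ℕ} (hP : ∀ p ∈ P, p.Prime) :
    Filter.Tendsto (fun n => subgroupZeta P n (Fin n → ℤ)) Filter.atTop
      (nhds (ENNReal.ofReal (∏ p ∈ P, (qPochhammerInf (p : ℝ)⁻¹ (p : ℝ)⁻¹)⁻¹))) := by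
  simp_rw [subgroupZeta_int_pow hP]
  refine ENNReal.tendsto_ofReal (tendsto_finsetProd _ fun p hp => ?_)
  have h1 : (1 : ℝ) < p := by exact_mod_cast (hP p hp).one_lt
  have habs : |(p : ℝ)⁻¹| < 1 := by
    rw [abs_of_pos (by positivity)]
    exact inv_lt_one_of_one_lt₀ h1
  exact (multipliable_qPochhammerInf _ _ habs).hasProd.tendsto_prod_nat.inv₀
    (qPochhammerInf_pos (hP p hp)).ne'

/-! ### Self-similarity of finite-index subgroups -/

theorem nonempty_int_pow_equiv_of_index_ne_zero {n : ℕ} (M : AddSubgroup (Fin n → ℤ))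
    (hM : M.index ≠ 0) : Nonempty (M ≃+ (Fin n → ℤ)) := by
  have : M.FiniteIndex := ⟨hM⟩
  let N : Submodule ℤ (Fin n → ℤ) := AddSubgroup.toIntSubmodule M
  have hfin : Finite ((Fin n → ℤ) ⧸ N) := inferInstanceAs (Finite ((Fin n → ℤ) ⧸ M))
  have hr := (Submodule.finiteQuotient_iff N).1 hfin
  rw [Module.finrank_fin_fun] at hr
  let b := Module.finBasisOfFinrankEq ℤ N hr
  exact ⟨b.equivFun.toAddEquiv⟩

/-- Transport the zeta sum along `M ≃ ℤ ^ n` and use multiplicativity of the index in `L ≤ M ≤ ℤ ^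
n`. -/
theorem tsum_smoothWeight_index_Iic (P : Finset ℕ) {n : ℕ} (M : AddSubgroup (Fin n → ℤ)) :
    ∑' L : Set.Iic M, smoothWeight P n (L : AddSubgroup (Fin n → ℤ)).index =
      smoothWeight P n M.index * subgroupZeta P n (Fin n → ℤ) := by
  by_cases hM : M.index = 0
  · rw [hM, smoothWeight_zero, zero_mul, ENNReal.tsum_eq_zero]
    rintro ⟨L, hL⟩
    have : L.index = 0 := Nat.eq_zero_of_zero_dvd (hM ▸ AddSubgroup.index_dvd_of_le hL)
    simp [this]
  · obtain ⟨e⟩ := nonempty_int_pow_equiv_of_index_ne_zero M hM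
    rw [← subgroupZeta_congr P n e, subgroupZeta, ← ENNReal.tsum_mul_left,
      tsum_subtype (Set.Iic M) fun L => smoothWeight P n L.index]
    have hinj : Function.Injective fun K : AddSubgroup M => K.map M.subtype :=
      AddSubgroup.map_injective M.subtype_injective
    rw [← hinj.tsum_eq]
    · refine tsum_congr fun K => ?_
      rw [Set.indicator_of_mem (show K.map M.subtype ∈ Set.Iic M from AddSubgroup.map_subtype_le K),
        AddSubgroup.index_map_subtype, smoothWeight_mul, mul_comm]
    · intro L hL
      have hLM : L ≤ M := by
        by_contra hc
        exact hL (Set.indicator_of_notMem hc _)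
      exact ⟨L.addSubgroupOf M, by simp [AddSubgroup.map_addSubgroupOf_eq_of_le hLM]⟩

/-! ### Chains in a poset and Möbius uniqueness -/

section Chains

variable {α : Type*} [PartialOrder α]

/-- The sum over chains `L = H_0 ≤ ⋯ ≤ H_k = M` of `∏_{i < k} s (H_i)`. -/
noncomputable def weightedChains (s : α → ℝ≥0∞) : ℕ → α → α → ℝ≥0∞
  | 0, L, M => ({L} : Set α).indicator 1 M
  | k + 1, L, M => ∑' L' : Set.Iic M, s L' * weightedChains s k L L'

theorem weightedChains_of_not_le (s : α → ℝ≥0∞) (k : ℕ) {L M : α} (h : ¬ L ≤ M) :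
    weightedChains s k L M = 0 := by
  induction k generalizing M with
  | zero =>
    refine Set.indicator_of_notMem (fun hM => h ?_) _
    rw [Set.mem_singleton_iff.1 hM]
  | succ k ih =>
    refine ENNReal.tsum_eq_zero.2 fun L' => ?_
    rw [ih fun hL => h (hL.trans L'.2), mul_zero]

/-- A chain with `k + 2` terms is determined by its top term and the chain below. -/
def chainSuccEquiv (k : ℕ) (L M : α) :
    {H : Fin (k + 1 + 1) → α // Monotone H ∧ H 0 = L ∧ H (Fin.last (k + 1)) = M} ≃
      Σ L' : Set.Iic M, {H : Fin (k + 1) → α // Monotone H ∧ H 0 = L ∧ H (Fin.last k) = L'} where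
  toFun H := ⟨⟨H.1 (Fin.last k).castSucc, (H.2.1 (Fin.le_last _)).trans_eq H.2.2.2⟩,
    ⟨fun i => H.1 i.castSucc, fun i j h => H.2.1 (Fin.castSucc_le_castSucc_iff.2 h),
      by simpa using H.2.2.1, rfl⟩⟩
  invFun x := ⟨Fin.snoc (α := fun _ => α) x.2.1 M, by
    obtain ⟨⟨L', hL'⟩, H, hH, h0, hl⟩ := x
    refine ⟨fun i j => ?_, ?_, by simp⟩
    · refine Fin.lastCases (fun _ => ?_) (fun j => ?_) j <;>
        refine Fin.lastCases ?_ (fun i => ?_) i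
      · exact le_rfl
      · simp only [Fin.snoc_last, Fin.snoc_castSucc]
        exact ((hH (Fin.le_last i)).trans hl.le).trans hL'
      · intro h
        exact absurd (Fin.castSucc_lt_last j) (not_lt.2 h)
      · intro h
        simp only [Fin.snoc_castSucc]
        exact hH (Fin.castSucc_le_castSucc_iff.1 h)
    · change Fin.snoc (α := fun _ => α) H M (Fin.castSucc 0) = L
      rw [Fin.snoc_castSucc]
      exact h0⟩
  left_inv H := by
    apply Subtype.ext
    funext i
    refine Fin.lastCases ?_ (fun i => ?_) i
    · simp [H.2.2.2]
    · simp
  right_inv x := by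
    -- The component `L'` is the last term of the chain, so equality of the underlying functions
    -- suffices.
    have ext : ∀ x y : Σ L' : Set.Iic M,
        {H : Fin (k + 1) → α // Monotone H ∧ H 0 = L ∧ H (Fin.last k) = L'},
        x.2.1 = y.2.1 → x = y := by
      rintro ⟨⟨a, ha⟩, H, hH, h0, hl⟩ ⟨⟨b, hb⟩, H', hH', h0', hl'⟩ (rfl : H = H')
      obtain rfl : a = b := hl.symm.trans hl'
      rfl
    refine ext _ _ ?_
    funext i
    simp

theorem card_chains_eq_weightedChains [Finite α] (k : ℕ) (L M : α) :
    (Nat.card {H : Fin (k + 1) → α // Monotone H ∧ H 0 = L ∧ H (Fin.last k) = M} : ℝ≥0∞) =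
      weightedChains 1 k L M := by
  induction k generalizing M with
  | zero =>
    rw [weightedChains]
    by_cases h : M = L
    · subst h
      rw [Set.indicator_of_mem (Set.mem_singleton M), Pi.one_apply, Nat.cast_eq_one,
        Nat.card_eq_one_iff_unique]
      refine ⟨⟨?_⟩, ⟨⟨fun _ => M, monotone_const, rfl, rfl⟩⟩⟩
      rintro ⟨H, -, h, -⟩ ⟨H', -, h', -⟩
      apply Subtype.ext
      funext i
      obtain rfl : i = 0 := Fin.ext (by omega)
      exact h.trans h'.symm
    · rw [Set.indicator_of_notMem (by simpa using h), Nat.cast_eq_zero, Nat.card_eq_zero]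
      refine Or.inl ⟨?_⟩
      rintro ⟨H, -, h0, hl⟩
      exact h (hl.symm.trans h0)
  | succ k ih =>
    have := Fintype.ofFinite (Set.Iic M)
    rw [Nat.card_congr (chainSuccEquiv k L M), Nat.card_sigma, weightedChains, tsum_fintype,
      Nat.cast_sum]
    refine Finset.sum_congr rfl fun L' _ => ?_
    rw [ih, Pi.one_apply, one_mul]

-- Everything above `e b₀` lies in the range of `e`, so no chain starting at `e b₀` leaves it. This
-- is applied to the subgroups of `A ⧸ L` inside those of `A`.
open Classical in
theorem weightedChains_one_comp {β : Type*} [PartialOrder β] (e : β ↪o α) (b₀ : β)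
    (he : ∀ a, e b₀ ≤ a → a ∈ Set.range e) (k : ℕ) (b : β) :
    weightedChains 1 k (e b₀) (e b) = weightedChains 1 k b₀ b := by
  induction k generalizing b with
  | zero =>
    rw [weightedChains, weightedChains, Set.indicator_apply, Set.indicator_apply]
    simp
  | succ k ih =>
    simp only [weightedChains, Pi.one_apply, one_mul]
    rw [tsum_subtype (Set.Iic (e b)) fun a => weightedChains 1 k (e b₀) a,
      tsum_subtype (Set.Iic b) fun a => weightedChains 1 k b₀ a, ← e.injective.tsum_eq]
    · refine tsum_congr fun b' => ?_
      rw [Set.indicator_apply, Set.indicator_apply]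
      simp [ih]
    · intro a ha
      refine he a ?_
      by_contra hc
      refine ha ?_
      rw [Set.indicator_apply, weightedChains_of_not_le 1 k hc, ite_self]

open Classical in
/-- Möbius uniqueness: functions with the same sums over lower intervals agree. -/
theorem eq_of_tsum_Iic_eq [Finite α] {f g : α → ℝ≥0∞} {K : α}
    (h : ∀ H ≤ K, ∑' H' : Set.Iic H, f H' = ∑' H' : Set.Iic H, g H') (hg : ∀ H, g H ≠ ∞)
    {H : α} (hH : H ≤ K) : f H = g H := by
  induction H using WellFoundedLT.induction with
  | ind H ih =>
    have hs := h H hH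
    let H₀ : Set.Iic H := ⟨H, Set.mem_Iic.2 le_rfl⟩
    rw [ENNReal.tsum_eq_add_tsum_ite (f := fun H' : Set.Iic H => f H') H₀,
      ENNReal.tsum_eq_add_tsum_ite (f := fun H' : Set.Iic H => g H') H₀] at hs
    have hr : ∀ (x : Set.Iic H) [Decidable (x = H₀)], (if x = H₀ then 0 else f x) =
        if x = H₀ then 0 else g x := by
      intro x _
      split_ifs with hx
      · rfl
      · exact ih x (lt_of_le_of_ne x.2 fun he => hx (Subtype.ext he)) (x.2.trans hH)
    simp only [hr] at hs
    -- Cancellation in `ℝ≥0∞` requires the common sum over `H' < H` to be finite; this is where `hg`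
    -- and finiteness of the poset enter.
    refine (ENNReal.add_left_inj ?_).1 hs
    have := Fintype.ofFinite (Set.Iic H)
    rw [tsum_fintype]
    refine ENNReal.sum_ne_top.2 fun x _ => ?_
    split_ifs
    · simp
    · exact hg x

end Chains

theorem chainCount_quotient {A : Type*} [AddCommGroup A] (k : ℕ) (L : AddSubgroup A)
    [Finite (A ⧸ L)] : (chainCount k (A ⧸ L) : ℝ≥0∞) = weightedChains 1 k L ⊤ := by
  rw [chainCount, card_chains_eq_weightedChains]
  have hs := QuotientAddGroup.mk'_surjective L
  let e : AddSubgroup (A ⧸ L) ↪o AddSubgroup A :=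
    { toFun := AddSubgroup.comap (QuotientAddGroup.mk' L)
      inj' := AddSubgroup.comap_injective hs
      map_rel_iff' := AddSubgroup.comap_le_comap_of_surjective hs }
  have h0 : e ⊥ = L := QuotientAddGroup.ker_mk' L
  have h1 : e ⊤ = ⊤ := rfl
  rw [← weightedChains_one_comp e ⊥, h0, h1]
  intro a ha
  rw [h0] at ha
  refine ⟨a.map (QuotientAddGroup.mk' L), ?_⟩
  change AddSubgroup.comap _ _ = _
  rw [AddSubgroup.comap_map_eq, QuotientAddGroup.ker_mk', sup_eq_left.2 ha]

/-! ### Generation by `n` random elements -/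

/-- Homomorphisms out of `ℤ ^ n` are `n`-tuples. -/
noncomputable def intPowHomEquiv (n : ℕ) (G : Type*) [AddCommGroup G] :
    ((Fin n → ℤ) →+ G) ≃ (Fin n → G) :=
  (addMonoidHomLequivInt ℤ).toEquiv.trans ((Pi.basisFun ℤ (Fin n)).constr ℤ).symm.toEquiv

instance finite_intPowHom (n : ℕ) (G : Type*) [AddCommGroup G] [Finite G] :
    Finite ((Fin n → ℤ) →+ G) :=
  Finite.of_equiv _ (intPowHomEquiv n G).symm

theorem card_intPowHom (n : ℕ) (G : Type*) [AddCommGroup G] [Finite G] :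
    Nat.card ((Fin n → ℤ) →+ G) = Nat.card G ^ n := by
  rw [Nat.card_congr (intPowHomEquiv n G), Nat.card_fun, Nat.card_fin]

/-- The number of homomorphisms from `ℤ ^ n` with range `H`. -/
noncomputable def genCount {G : Type*} [AddCommGroup G] (n : ℕ) (H : AddSubgroup G) : ℕ :=
  Nat.card {f : (Fin n → ℤ) →+ G // f.range = H}

/-- The probability that `n` random elements of `H` generate `H`. -/
noncomputable def genProb {G : Type*} [AddCommGroup G] (n : ℕ) (H : AddSubgroup G) : ℝ≥0∞ :=
  genCount n H * ((Nat.card H : ℝ≥0∞) ^ n)⁻¹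

/-- Sort the `#K ^ n` homomorphisms `ℤ ^ n → K` by their range. -/
theorem tsum_genCount {G : Type*} [AddCommGroup G] [Finite G] (n : ℕ) (K : AddSubgroup G) :
    ∑' H : Set.Iic K, (genCount n (H : AddSubgroup G) : ℝ≥0∞) = (Nat.card K : ℝ≥0∞) ^ n := by
  have := Fintype.ofFinite (Set.Iic K)
  let e : (Σ H : Set.Iic K, {f : (Fin n → ℤ) →+ G // f.range = H}) ≃ ((Fin n → ℤ) →+ K) :=
    { toFun := fun x => x.2.1.codRestrict K fun y =>
        x.1.2 (x.2.2.le ⟨y, rfl⟩)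
      invFun := fun f => ⟨⟨(K.subtype.comp f).range, by
        rintro _ ⟨y, rfl⟩
        exact (f y).2⟩, ⟨K.subtype.comp f, rfl⟩⟩
      left_inv := by
        rintro ⟨⟨H, h⟩, f, hf⟩
        change f.range = H at hf
        subst hf
        rfl
      right_inv := fun f => rfl }
  rw [tsum_fintype, ← Nat.cast_pow, ← card_intPowHom n K, ← Nat.card_congr e, Nat.card_sigma,
    Nat.cast_sum]
  rfl

theorem card_pow_ne_zero {G : Type*} [AddCommGroup G] [Finite G] (n : ℕ) (H : AddSubgroup G) :
    (Nat.card H : ℝ≥0∞) ^ n ≠ 0 :=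
  pow_ne_zero n (by exact_mod_cast Nat.card_pos.ne')

theorem card_pow_ne_top {G : Type*} [AddCommGroup G] (n : ℕ) (H : AddSubgroup G) :
    (Nat.card H : ℝ≥0∞) ^ n ≠ ∞ :=
  ENNReal.pow_ne_top (ENNReal.natCast_ne_top _)

theorem genCount_eq_genProb_mul {G : Type*} [AddCommGroup G] [Finite G] (n : ℕ)
    (H : AddSubgroup G) :
    (genCount n H : ℝ≥0∞) = genProb n H * (Nat.card H : ℝ≥0∞) ^ n := by
  rw [genProb, mul_assoc, ENNReal.inv_mul_cancel (card_pow_ne_zero n H) (card_pow_ne_top n H),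
    mul_one]

theorem genProb_le_one {G : Type*} [AddCommGroup G] [Finite G] (n : ℕ) (H : AddSubgroup G) :
    genProb n H ≤ 1 := by
  rw [genProb, ← div_eq_mul_inv]
  refine ENNReal.div_le_of_le_mul ?_
  rw [one_mul, ← tsum_genCount n H]
  exact ENNReal.le_tsum (f := fun K : Set.Iic H => (genCount n (K : AddSubgroup G) : ℝ≥0∞))
    ⟨H, Set.mem_Iic.2 le_rfl⟩

theorem smoothWeight_mul_pow {P : Finset ℕ} (n : ℕ) {m : ℕ} (hm : m ∈ Nat.factoredNumbers P) :
    smoothWeight P n m * (m : ℝ≥0∞) ^ n = 1 := by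
  rw [smoothWeight_of_mem n hm, ← mul_pow, ENNReal.inv_mul_cancel (by simpa using hm.1) (by simp),
    one_pow]

theorem IsAbelianPGroup.mem_factoredNumbers {P : Finset ℕ} {G : Type*} [AddCommGroup G]
    (hG : IsAbelianPGroup P G) : Nat.card G ∈ Nat.factoredNumbers P := by
  have := hG.1
  refine ⟨Nat.card_pos.ne', fun p hp => ?_⟩
  have hp' := (Nat.mem_primeFactorsList Nat.card_pos.ne').1 hp
  exact hG.2 p hp'.1 hp'.2

theorem isAbelianPGroup_of_mem_factoredNumbers {P : Finset ℕ} {G : Type*} [AddCommGroup G]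
    (hG : Nat.card G ∈ Nat.factoredNumbers P) : IsAbelianPGroup P G :=
  ⟨Nat.finite_of_card_ne_zero hG.1, fun p hp hd =>
    hG.2 p ((Nat.mem_primeFactorsList hG.1).2 ⟨hp, hd⟩)⟩

/-! ### Images of weighted subgroups and of chains -/

section MapSum

variable {P : Finset ℕ} {G : Type*} [AddCommGroup G] {n : ℕ} (φ : (Fin n → ℤ) →+ G)

/-- The weighted number of subgroups of `M` mapping onto `H`. -/
noncomputable def mapZeta (P : Finset ℕ) (φ : (Fin n → ℤ) →+ G) (M : AddSubgroup (Fin n → ℤ))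
    (H : AddSubgroup G) : ℝ≥0∞ :=
  ∑' L : AddSubgroup (Fin n → ℤ),
    {L | L ≤ M ∧ L.map φ = H}.indicator (fun L => smoothWeight P n L.index) L

/-- Sorting subgroups of `M` by their image. -/
theorem tsum_Iic_eq_tsum_mapZeta_mul (M : AddSubgroup (Fin n → ℤ)) (f : AddSubgroup G → ℝ≥0∞) :
    ∑' L : Set.Iic M, smoothWeight P n (L : AddSubgroup (Fin n → ℤ)).index * f (L.1.map φ) =
      ∑' H : Set.Iic (M.map φ), mapZeta P φ M H * f H := by
  classical
  rw [tsum_subtype (Set.Iic M) fun L => smoothWeight P n L.index * f (L.map φ)]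
  simp only [mapZeta, ← ENNReal.tsum_mul_right]
  rw [ENNReal.tsum_comm]
  refine tsum_congr fun L => ?_
  by_cases hL : L ≤ M
  · rw [tsum_eq_single ⟨L.map φ, Set.mem_Iic.2 (AddSubgroup.map_mono hL)⟩]
    · rw [Set.indicator_of_mem (Set.mem_Iic.2 hL), Set.indicator_of_mem]
      exact ⟨hL, rfl⟩
    · intro H hH
      rw [Set.indicator_of_notMem, zero_mul]
      exact fun h => hH (Subtype.ext h.2.symm)
  · rw [Set.indicator_of_notMem (show L ∉ Set.Iic M from hL), eq_comm, ENNReal.tsum_eq_zero]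
    intro H
    rw [Set.indicator_of_notMem fun h => hL h.1, zero_mul]

/-- The subgroups of `M` with image inside `H` are exactly the subgroups of `M ⊓ φ⁻¹(H)`, to which
self-similarity applies. -/
theorem tsum_mapZeta (M : AddSubgroup (Fin n → ℤ)) {H : AddSubgroup G} (hH : H ≤ M.map φ) :
    ∑' H' : Set.Iic H, mapZeta P φ M H' =
      smoothWeight P n (M ⊓ H.comap φ).index * subgroupZeta P n (Fin n → ℤ) := by
  rw [← tsum_smoothWeight_index_Iic]
  have h := tsum_Iic_eq_tsum_mapZeta_mul (P := P) φ M ((Set.Iic H).indicator 1)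
  rw [tsum_subtype (Set.Iic (M.map φ)) fun H' => mapZeta P φ M H' * (Set.Iic H).indicator 1 H',
    tsum_subtype (Set.Iic M) fun L =>
      smoothWeight P n L.index * (Set.Iic H).indicator 1 (L.map φ)] at h
  rw [tsum_subtype (Set.Iic H) fun H' => mapZeta P φ M H',
    tsum_subtype (Set.Iic (M ⊓ H.comap φ)) fun L => smoothWeight P n L.index]
  convert h.symm using 3 with H' L
  · by_cases h1 : H' ≤ H
    · rw [Set.indicator_of_mem (Set.mem_Iic.2 h1),
        Set.indicator_of_mem (Set.mem_Iic.2 (h1.trans hH)),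
        Set.indicator_of_mem (Set.mem_Iic.2 h1), Pi.one_apply, mul_one]
    · rw [Set.indicator_of_notMem (show H' ∉ Set.Iic H from h1)]
      by_cases h2 : H' ≤ M.map φ
      · rw [Set.indicator_of_mem (Set.mem_Iic.2 h2),
          Set.indicator_of_notMem (show H' ∉ Set.Iic H from h1), mul_zero]
      · rw [Set.indicator_of_notMem (show H' ∉ Set.Iic (M.map φ) from h2)]
  · by_cases h1 : L ≤ M
    · rw [Set.indicator_of_mem (Set.mem_Iic.2 h1)]
      by_cases h2 : L.map φ ≤ H
      · rw [Set.indicator_of_mem (Set.mem_Iic.2 h2), Set.indicator_of_mem, Pi.one_apply, mul_one]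
        exact le_inf h1 (AddSubgroup.map_le_iff_le_comap.1 h2)
      · rw [Set.indicator_of_notMem (show L.map φ ∉ Set.Iic H from h2), mul_zero,
          Set.indicator_of_notMem]
        exact fun h => h2 (AddSubgroup.map_le_iff_le_comap.2 ((Set.mem_Iic.1 h).trans inf_le_right))
    · rw [Set.indicator_of_notMem (show L ∉ Set.Iic M from h1), Set.indicator_of_notMem]
      exact fun h => h1 ((Set.mem_Iic.1 h).trans inf_le_left)

/-- The index of `M ⊓ φ⁻¹(H)` in `M` equals that of `H` in `φ(M)`. It divides `#G`, so it is
`P`-smooth and its weight is not zero. -/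
theorem smoothWeight_index_inf_comap (hG : IsAbelianPGroup P G) (M : AddSubgroup (Fin n → ℤ))
    {H : AddSubgroup G} (hH : H ≤ M.map φ) :
    smoothWeight P n (M ⊓ H.comap φ).index * (Nat.card (M.map φ) : ℝ≥0∞) ^ n =
      smoothWeight P n M.index * (Nat.card H : ℝ≥0∞) ^ n := by
  have hc : Nat.card (M.map φ) = H.relIndex (M.map φ) * Nat.card H := by
    rw [mul_comm, ← AddSubgroup.relIndex_bot_left, ← AddSubgroup.relIndex_bot_left,
      AddSubgroup.relIndex_mul_relIndex _ _ _ bot_le hH]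
  have hmem : H.relIndex (M.map φ) ∈ Nat.factoredNumbers P :=
    Nat.mem_factoredNumbers_of_dvd hG.mem_factoredNumbers
      ((Dvd.intro _ hc.symm).trans (AddSubgroup.card_addSubgroup_dvd_card _))
  rw [← AddSubgroup.relIndex_mul_index (inf_le_left : M ⊓ H.comap φ ≤ M),
    AddSubgroup.inf_relIndex_left, AddSubgroup.relIndex_comap, smoothWeight_mul, hc, Nat.cast_mul,
    mul_pow]
  calc _ = (smoothWeight P n (H.relIndex (M.map φ)) * (H.relIndex (M.map φ) : ℝ≥0∞) ^ n) *
        (smoothWeight P n M.index * (Nat.card H : ℝ≥0∞) ^ n) := by ring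
    _ = _ := by rw [smoothWeight_mul_pow n hmem, one_mul]

/-- Both sides have the same sum over the subgroups of each `H ≤ φ(M)`, so they agree by Möbius
uniqueness. -/
theorem mapZeta_mul_pow (hP : ∀ p ∈ P, p.Prime) (hG : IsAbelianPGroup P G)
    (M : AddSubgroup (Fin n → ℤ)) {H : AddSubgroup G} (hH : H ≤ M.map φ) :
    mapZeta P φ M H * (Nat.card (M.map φ) : ℝ≥0∞) ^ n =
      smoothWeight P n M.index * subgroupZeta P n (Fin n → ℤ) * genCount n H := by
  have := hG.1
  refine eq_of_tsum_Iic_eq (K := M.map φ)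
    (f := fun H => mapZeta P φ M H * (Nat.card (M.map φ) : ℝ≥0∞) ^ n)
    (g := fun H => smoothWeight P n M.index * subgroupZeta P n (Fin n → ℤ) * genCount n H)
    (fun H hH => ?_) (fun H => ?_) hH
  · rw [ENNReal.tsum_mul_left, ENNReal.tsum_mul_right, tsum_genCount, tsum_mapZeta φ M hH,
      mul_right_comm, smoothWeight_index_inf_comap φ hG M hH]
    ring
  · exact ENNReal.mul_ne_top
      (ENNReal.mul_ne_top (smoothWeight_ne_top _ _ _) (subgroupZeta_int_pow_ne_top hP n))
      (ENNReal.natCast_ne_top _)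

/-- The weighted number of chains `L = L_0 ≤ ⋯ ≤ L_k = M` with `L ≤ ker φ`. -/
noncomputable def kerChainZeta (P : Finset ℕ) (φ : (Fin n → ℤ) →+ G) (k : ℕ)
    (M : AddSubgroup (Fin n → ℤ)) : ℝ≥0∞ :=
  ∑' L : Set.Iic φ.ker, smoothWeight P n (L : AddSubgroup (Fin n → ℤ)).index *
    weightedChains 1 k (L : AddSubgroup (Fin n → ℤ)) M

theorem kerChainZeta_succ (k : ℕ) (M : AddSubgroup (Fin n → ℤ)) :
    kerChainZeta P φ (k + 1) M = ∑' L' : Set.Iic M, kerChainZeta P φ k L' := by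
  simp only [kerChainZeta, weightedChains, Pi.one_apply, one_mul, ← ENNReal.tsum_mul_left]
  exact ENNReal.tsum_comm

theorem kerChainZeta_zero (M : AddSubgroup (Fin n → ℤ)) :
    kerChainZeta P φ 0 M = smoothWeight P n M.index * ({⊥} : Set (AddSubgroup G)).indicator 1
      (M.map φ) := by
  have hiff : M.map φ = ⊥ ↔ M ≤ φ.ker := by
    rw [← le_bot_iff, AddSubgroup.map_le_iff_le_comap, AddMonoidHom.comap_bot]
  rw [kerChainZeta]
  by_cases h : M ≤ φ.ker
  · rw [tsum_eq_single ⟨M, Set.mem_Iic.2 h⟩, weightedChains,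
      Set.indicator_of_mem (Set.mem_singleton M), Set.indicator_of_mem]
    · rfl
    · exact hiff.2 h
    · intro L hL
      rw [weightedChains, Set.indicator_of_notMem, mul_zero]
      exact fun hM => hL (Subtype.ext (Set.mem_singleton_iff.1 hM).symm)
  · rw [Set.indicator_of_notMem (show M.map φ ∉ ({⊥} : Set _) from fun hM => h (hiff.1 hM)),
      mul_zero, ENNReal.tsum_eq_zero]
    intro L
    rw [weightedChains, Set.indicator_of_notMem, mul_zero]
    intro hM
    rw [Set.mem_singleton_iff] at hM
    exact h (hM ▸ L.2)

/-- Induction on `k`, removing the top term `M`: the next term `L'` contributes through its image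
`H` only, and `mapZeta_mul_pow` supplies one factor `ζ_n` and one factor `genProb n H`. -/
theorem kerChainZeta_mul_pow (hP : ∀ p ∈ P, p.Prime) (hG : IsAbelianPGroup P G) (k : ℕ)
    (M : AddSubgroup (Fin n → ℤ)) :
    kerChainZeta P φ k M * (Nat.card (M.map φ) : ℝ≥0∞) ^ n =
      smoothWeight P n M.index * subgroupZeta P n (Fin n → ℤ) ^ k *
        weightedChains (genProb n) k ⊥ (M.map φ) := by
  have := hG.1
  induction k generalizing M with
  | zero =>
    rw [kerChainZeta_zero, weightedChains]
    by_cases h : M.map φ = ⊥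
    · rw [h]
      simp
    · rw [Set.indicator_of_notMem (by simpa using h)]
      simp
  | succ k ih =>
    -- Divided by `#φ(L) ^ n`, the induction hypothesis is the weight of `L` times a function of its
    -- image, the form required for sorting by image.
    have hdiv : ∀ L : AddSubgroup (Fin n → ℤ), kerChainZeta P φ k L =
        smoothWeight P n L.index * (subgroupZeta P n (Fin n → ℤ) ^ k *
          weightedChains (genProb n) k ⊥ (L.map φ) * ((Nat.card (L.map φ) : ℝ≥0∞) ^ n)⁻¹) := by
      intro L
      rw [← mul_assoc, ← mul_assoc, ← ih, mul_assoc,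
        ENNReal.mul_inv_cancel (card_pow_ne_zero n _) (card_pow_ne_top n _), mul_one]
    rw [kerChainZeta_succ]
    simp only [hdiv]
    rw [tsum_Iic_eq_tsum_mapZeta_mul φ M fun H => subgroupZeta P n (Fin n → ℤ) ^ k *
          weightedChains (genProb n) k ⊥ H * ((Nat.card H : ℝ≥0∞) ^ n)⁻¹, weightedChains,
      ← ENNReal.tsum_mul_right, ← ENNReal.tsum_mul_left]
    refine tsum_congr fun H => ?_
    rw [mul_right_comm, mapZeta_mul_pow φ hP hG M H.2, genProb]
    ring

end MapSum

/-! ### Surjections, quotients and automorphisms -/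

/-- Surjections from `A` onto `B` are pairs of a subgroup `L` and an isomorphism `A ⧸ L ≃ B`. -/
noncomputable def surjectiveHomEquiv (A B : Type*) [AddCommGroup A] [AddCommGroup B] :
    {f : A →+ B // Function.Surjective f} ≃ Σ L : AddSubgroup A, (A ⧸ L ≃+ B) where
  toFun f := ⟨f.1.ker, QuotientAddGroup.quotientKerEquivOfSurjective f.1 f.2⟩
  invFun x := ⟨x.2.toAddMonoidHom.comp (QuotientAddGroup.mk' x.1),
    x.2.surjective.comp (QuotientAddGroup.mk'_surjective x.1)⟩
  left_inv f := by
    ext x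
    rfl
  right_inv x := by
    obtain ⟨L, e⟩ := x
    have ext : ∀ x y : Σ L : AddSubgroup A, (A ⧸ L ≃+ B), x.1 = y.1 →
        (∀ a : A, x.2 (a : A ⧸ x.1) = y.2 (a : A ⧸ y.1)) → x = y := by
      rintro ⟨L, e⟩ ⟨L', e'⟩ (rfl : L = L') h
      congr 1
      ext q
      obtain ⟨a, rfl⟩ := QuotientAddGroup.mk_surjective q
      exact h a
    refine ext _ _ ?_ fun a => rfl
    ext a
    simp

/-- For a fixed kernel `L`, one chosen isomorphism `A ⧸ L ≃ B` identifies all the others with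
`Aut(B)`. -/
theorem card_quotient_equiv_mul_autCount (A B : Type*) [AddCommGroup A] [AddCommGroup B]
    [Finite (A →+ B)] :
    Nat.card {L : AddSubgroup A // Nonempty (A ⧸ L ≃+ B)} * autCount B = surCount A B := by
  rw [surCount, autCount, ← Nat.card_prod]
  refine Nat.card_congr (Equiv.trans ?_ (surjectiveHomEquiv A B).symm)
  exact
    { toFun := fun x => ⟨x.1.1, x.1.2.some.trans x.2⟩
      invFun := fun x => ⟨⟨x.1, ⟨x.2⟩⟩, (Nonempty.some ⟨x.2⟩).symm.trans x.2⟩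
      left_inv := by
        rintro ⟨⟨L, hL⟩, e⟩
        ext x <;> simp
      right_inv := by
        rintro ⟨L, e⟩
        exact Sigma.ext rfl (heq_of_eq (AddEquiv.ext fun x => by simp)) }

instance finite_setOf_quotient_equiv (A B : Type*) [AddCommGroup A] [AddCommGroup B]
    [Finite (A →+ B)] : Finite {L : AddSubgroup A // Nonempty (A ⧸ L ≃+ B)} :=
  Finite.of_injective
    (fun L => (surjectiveHomEquiv A B).symm ⟨L.1, L.2.some⟩) fun L L' h => by
      have := (surjectiveHomEquiv A B).symm.injective h
      exact Subtype.ext (congrArg Sigma.fst this)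

theorem surCount_quotient {A G : Type*} [AddCommGroup A] [AddCommGroup G] (L : AddSubgroup A) :
    surCount (A ⧸ L) G = Nat.card {f : {f : A →+ G // Function.Surjective f} // L ≤ f.1.ker} := by
  refine Nat.card_congr
    { toFun := fun f => ⟨⟨f.1.comp (QuotientAddGroup.mk' L),
        f.2.comp (QuotientAddGroup.mk'_surjective L)⟩, fun x hx => by
          simp [AddMonoidHom.mem_ker, (QuotientAddGroup.eq_zero_iff x).2 hx]⟩
      invFun := fun f => ⟨QuotientAddGroup.lift L f.1.1 f.2,
        QuotientAddGroup.lift_surjective_of_surjective _ _ f.1.2 _⟩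
      left_inv := fun f => by
        ext x
        rfl
      right_inv := fun f => by
        ext x
        rfl }

theorem genCount_top_eq_surCount (n : ℕ) (B : Type*) [AddCommGroup B] :
    genCount n (⊤ : AddSubgroup B) = surCount (Fin n → ℤ) B :=
  Nat.card_congr (Equiv.subtypeEquivRight fun _ => AddMonoidHom.range_eq_top)

theorem autCount_pos (B : Type*) [AddCommGroup B] [Finite B] : 0 < autCount B := by
  have : Finite (B ≃+ B) := Finite.of_injective (fun e => (e : B → B)) DFunLike.coe_injective
  exact Nat.card_pos

/-! ### Sums over isomorphism classes -/

/-- The isomorphism class of a group. -/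
def AbelianPClass.mk {P : Finset ℕ} (B : AbelianPGroup P) : AbelianPClass P :=
  Quotient.mk (AbelianPGroup.setoid P) B

/-- A representative of an isomorphism class. -/
noncomputable def AbelianPClass.rep {P : Finset ℕ} (C : AbelianPClass P) : AbelianPGroup P :=
  Quotient.out (s := AbelianPGroup.setoid P) C

theorem AbelianPClass.mk_rep_eq {P : Finset ℕ} (C : AbelianPClass P) : mk C.rep = C :=
  Quotient.out_eq (s := AbelianPGroup.setoid P) C

theorem AbelianPClass.mk_rep {P : Finset ℕ} (B : AbelianPGroup P) :
    Nonempty ((mk B).rep.carrier ≃+ B.carrier) :=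
  Quotient.mk_out (s := AbelianPGroup.setoid P) B

/-- Groups in `𝒜_P` obtained as quotients of `ℤ ^ n`, sorted by isomorphism class. -/
theorem tsum_class_eq_tsum_subgroup {P : Finset ℕ} {A : Type} [AddCommGroup A]
    (T : AddSubgroup A → ℝ≥0∞) (hT : ∀ L, L.index ∉ Nat.factoredNumbers P → T L = 0) :
    ∑' C : AbelianPClass P,
      ∑' L : {L : AddSubgroup A // Nonempty (A ⧸ L ≃+ C.rep.carrier)}, T L =
      ∑' L, T L := by
  have h1 : ∀ C : AbelianPClass P,
      ∑' L : {L : AddSubgroup A // Nonempty (A ⧸ L ≃+ C.rep.carrier)}, T L =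
      ∑' L, {L : AddSubgroup A | Nonempty (A ⧸ L ≃+ C.rep.carrier)}.indicator T L :=
    fun C => tsum_subtype {L : AddSubgroup A | Nonempty (A ⧸ L ≃+ C.rep.carrier)} T
  simp only [h1]
  rw [ENNReal.tsum_comm]
  refine tsum_congr fun L => ?_
  by_cases hL : L.index ∈ Nat.factoredNumbers P
  · let Q : AbelianPGroup P := ⟨A ⧸ L, isAbelianPGroup_of_mem_factoredNumbers hL⟩
    rw [tsum_eq_single (AbelianPClass.mk Q)]
    · rw [Set.indicator_of_mem]
      obtain ⟨e⟩ := AbelianPClass.mk_rep Q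
      exact ⟨e.symm⟩
    · intro C hC
      refine Set.indicator_of_notMem (fun h => hC ?_) _
      obtain ⟨e⟩ := h
      rw [← C.mk_rep_eq]
      exact Quotient.sound (show Nonempty _ from ⟨e.symm⟩)
  · rw [hT L hL, ENNReal.tsum_eq_zero]
    intro C
    rw [Set.indicator_apply_eq_zero]
    exact fun _ => hT L hL

/-- Surjections from `ℤ ^ n ⧸ L` are surjections `φ` from `ℤ ^ n` with `L ≤ ker φ`; exchange the
sums over `L` and `φ`. -/
theorem tsum_kerChainZeta {P : Finset ℕ} {G : Type*} [AddCommGroup G] [Finite G] (k n : ℕ) :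
    ∑' L : AddSubgroup (Fin n → ℤ), smoothWeight P n L.index *
      (chainCount k ((Fin n → ℤ) ⧸ L) * surCount ((Fin n → ℤ) ⧸ L) G) =
    ∑' φ : {φ : (Fin n → ℤ) →+ G // Function.Surjective φ}, kerChainZeta P φ.1 k ⊤ := by
  classical
  have h1 : ∀ φ : (Fin n → ℤ) →+ G, kerChainZeta P φ k ⊤ =
      ∑' L, (Set.Iic φ.ker).indicator (fun L : AddSubgroup (Fin n → ℤ) =>
        smoothWeight P n L.index * weightedChains 1 k L ⊤) L := fun φ =>
    tsum_subtype (Set.Iic φ.ker) fun L : AddSubgroup (Fin n → ℤ) =>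
        smoothWeight P n L.index * weightedChains 1 k L ⊤
  simp only [h1]
  rw [ENNReal.tsum_comm]
  refine tsum_congr fun L => ?_
  by_cases hL : L.index = 0
  · rw [hL, smoothWeight_zero, zero_mul, eq_comm, ENNReal.tsum_eq_zero]
    intro φ
    rw [Set.indicator_apply_eq_zero]
    intro _
    rw [hL, smoothWeight_zero, zero_mul]
  · have : L.FiniteIndex := ⟨hL⟩
    have : Fintype {φ : (Fin n → ℤ) →+ G // Function.Surjective φ} := Fintype.ofFinite _
    rw [chainCount_quotient, surCount_quotient, tsum_fintype]
    simp only [Set.indicator_apply, Set.mem_Iic]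
    rw [Finset.sum_ite, Finset.sum_const_zero, add_zero, Finset.sum_const, nsmul_eq_mul,
      Nat.card_eq_fintype_card, Fintype.card_subtype]
    ring

/-- The moment identity at level `n`. -/
theorem tsum_class_genProb {P : Finset ℕ} (hP : ∀ p ∈ P, p.Prime) {G : Type*} [AddCommGroup G]
    (hG : IsAbelianPGroup P G) (k n : ℕ) :
    ∑' C : AbelianPClass P, (chainCount k C.rep.carrier : ℝ≥0∞) *
        (autCount C.rep.carrier : ℝ≥0∞)⁻¹ * surCount C.rep.carrier G *
        genProb n (⊤ : AddSubgroup C.rep.carrier) =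
      genProb n (⊤ : AddSubgroup G) * (subgroupZeta P n (Fin n → ℤ) ^ k *
        weightedChains (genProb n) k ⊥ (⊤ : AddSubgroup G)) := by
  have := hG.1
  let T : AddSubgroup (Fin n → ℤ) → ℝ≥0∞ := fun L => smoothWeight P n L.index *
      (chainCount k ((Fin n → ℤ) ⧸ L) * surCount ((Fin n → ℤ) ⧸ L) G)
  have hT : ∀ L, L.index ∉ Nat.factoredNumbers P → T L = 0 := fun L hL => by
    simp only [T, smoothWeight_of_notMem n hL, zero_mul]
  trans ∑' C : AbelianPClass P, ∑' L : {L : AddSubgroup (Fin n → ℤ) //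
      Nonempty ((Fin n → ℤ) ⧸ L ≃+ C.rep.carrier)}, T L
  · refine tsum_congr fun C => ?_
    generalize C.rep = B
    have hB := B.isAbelianPGroup
    have := hB.1
    have ha : (autCount B.carrier : ℝ≥0∞) ≠ 0 := by exact_mod_cast (autCount_pos B.carrier).ne'
    -- All `L` with quotient `B` contribute equally, and there are `#Sur(ℤ ^ n, B) / #Aut(B)` of
    -- them.
    have hc : ∀ L : {L : AddSubgroup (Fin n → ℤ) // Nonempty ((Fin n → ℤ) ⧸ L ≃+ B.carrier)},
        T L = ((Nat.card B.carrier : ℝ≥0∞) ^ n)⁻¹ *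
          (chainCount k B.carrier * surCount B.carrier G) := by
      rintro ⟨L, ⟨e⟩⟩
      have hi : L.index = Nat.card B.carrier := Nat.card_congr e.toEquiv
      simp only [T, chainCount_congr k e, surCount_congr G e, hi,
        smoothWeight_of_mem n hB.mem_factoredNumbers, ENNReal.inv_pow]
    have := Fintype.ofFinite
      {L : AddSubgroup (Fin n → ℤ) // Nonempty ((Fin n → ℤ) ⧸ L ≃+ B.carrier)}
    rw [tsum_congr hc, tsum_fintype, Finset.sum_const, Finset.card_univ, nsmul_eq_mul, genProb,
      genCount_top_eq_surCount, ← card_quotient_equiv_mul_autCount (Fin n → ℤ), Nat.cast_mul,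
      AddSubgroup.card_top, Nat.card_eq_fintype_card (α := {L : AddSubgroup (Fin n → ℤ) // _})]
    calc _ = (autCount B.carrier : ℝ≥0∞)⁻¹ * autCount B.carrier *
          (Fintype.card {L : AddSubgroup (Fin n → ℤ) //
            Nonempty ((Fin n → ℤ) ⧸ L ≃+ B.carrier)} * (((Nat.card B.carrier : ℝ≥0∞) ^ n)⁻¹ *
              (chainCount k B.carrier * surCount B.carrier G))) := by ring
      _ = _ := by rw [ENNReal.inv_mul_cancel ha (ENNReal.natCast_ne_top _), one_mul]
  · rw [tsum_class_eq_tsum_subgroup T hT, tsum_kerChainZeta]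
    have hφ : ∀ φ : {φ : (Fin n → ℤ) →+ G // Function.Surjective φ}, kerChainZeta P φ.1 k ⊤ =
        subgroupZeta P n (Fin n → ℤ) ^ k * weightedChains (genProb n) k ⊥ (⊤ : AddSubgroup G) *
          ((Nat.card (⊤ : AddSubgroup G) : ℝ≥0∞) ^ n)⁻¹ := by
      intro φ
      have h := kerChainZeta_mul_pow φ.1 hP hG k ⊤
      rw [AddSubgroup.map_top_of_surjective _ φ.2, AddSubgroup.index_top, smoothWeight_one,
        one_mul] at h
      rw [← h, mul_assoc, ENNReal.mul_inv_cancel (card_pow_ne_zero n _) (card_pow_ne_top n _),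
        mul_one]
    have : Fintype {φ : (Fin n → ℤ) →+ G // Function.Surjective φ} := Fintype.ofFinite _
    rw [tsum_congr hφ, tsum_fintype, Finset.sum_const, Finset.card_univ, nsmul_eq_mul, genProb,
      genCount_top_eq_surCount, surCount,
      Nat.card_eq_fintype_card (α := {φ : (Fin n → ℤ) →+ G // _})]
    ring

/-! ### The limit `n → ∞` -/

-- Union bound: `n` elements of `H` that fail to generate it all lie in some proper subgroup `K`,
-- which has probability `(#K / #H) ^ n`.
open Classical in
theorem one_le_genProb_add {G : Type*} [AddCommGroup G] [Finite G]
    [Fintype (AddSubgroup G)] (n : ℕ) (H : AddSubgroup G) :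
    1 ≤ genProb n H + ∑ K ∈ Finset.univ.filter (· < H),
      ((Nat.card K : ℝ≥0∞) * (Nat.card H : ℝ≥0∞)⁻¹) ^ n := by
  have hle : (Nat.card H : ℝ≥0∞) ^ n ≤
      genCount n H + ∑ K ∈ Finset.univ.filter (· < H), (Nat.card K : ℝ≥0∞) ^ n := by
    rw [← tsum_genCount n H, tsum_subtype (Set.Iic H) fun K => (genCount n K : ℝ≥0∞), tsum_fintype]
    have hs : Finset.univ.filter (· ≤ H) = insert H (Finset.univ.filter (· < H)) := by
      ext K
      simp [le_iff_lt_or_eq, or_comm]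
    simp only [Set.indicator_apply, Set.mem_Iic]
    rw [← Finset.sum_filter, hs, Finset.sum_insert (by simp)]
    gcongr with K
    rw [genCount_eq_genProb_mul]
    exact mul_le_of_le_one_left' (genProb_le_one n K)
  calc (1 : ℝ≥0∞) = (Nat.card H : ℝ≥0∞) ^ n * ((Nat.card H : ℝ≥0∞) ^ n)⁻¹ :=
        (ENNReal.mul_inv_cancel (card_pow_ne_zero n H) (card_pow_ne_top n H)).symm
    _ ≤ (genCount n H + ∑ K ∈ Finset.univ.filter (· < H), (Nat.card K : ℝ≥0∞) ^ n) *
        ((Nat.card H : ℝ≥0∞) ^ n)⁻¹ := by gcongr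
    _ = _ := by
      rw [add_mul, Finset.sum_mul, genProb]
      simp only [mul_pow, ENNReal.inv_pow]

theorem tendsto_genProb {G : Type*} [AddCommGroup G] [Finite G] (H : AddSubgroup G) :
    Filter.Tendsto (fun n => genProb n H) Filter.atTop (nhds 1) := by
  classical
  have := Fintype.ofFinite (AddSubgroup G)
  have hlim : Filter.Tendsto (fun n => 1 - ∑ K ∈ Finset.univ.filter (· < H),
      ((Nat.card K : ℝ≥0∞) * (Nat.card H : ℝ≥0∞)⁻¹) ^ n) Filter.atTop
      (nhds (1 - ∑ K ∈ Finset.univ.filter (· < H), 0)) := by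
    refine ENNReal.Tendsto.sub tendsto_const_nhds (tendsto_finsetSum _ fun K hK => ?_)
      (Or.inl ENNReal.one_ne_top)
    refine ENNReal.tendsto_pow_atTop_nhds_zero_of_lt_one ?_
    rw [← div_eq_mul_inv]
    have hlt : Nat.card K < Nat.card H :=
      Set.Finite.card_lt_card (Set.toFinite _) (SetLike.coe_ssubset_coe.2 (Finset.mem_filter.1 hK).2)
    refine ENNReal.div_lt_of_lt_mul ?_
    rw [one_mul]
    exact_mod_cast hlt
  rw [Finset.sum_const_zero, tsub_zero] at hlim
  exact tendsto_of_tendsto_of_tendsto_of_le_of_le hlim tendsto_const_nhds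
    (fun n => tsub_le_iff_right.2 (one_le_genProb_add n H)) fun n => genProb_le_one n H

theorem tendsto_weightedChains {α : Type*} [PartialOrder α] [Finite α] {s : ℕ → α → ℝ≥0∞}
    (hs : ∀ a, Filter.Tendsto (fun n => s n a) Filter.atTop (nhds 1)) (k : ℕ) (L M : α) :
    Filter.Tendsto (fun n => weightedChains (s n) k L M) Filter.atTop
      (nhds (weightedChains 1 k L M)) := by
  induction k generalizing M with
  | zero => exact tendsto_const_nhds
  | succ k ih =>
    have := Fintype.ofFinite (Set.Iic M)
    simp only [weightedChains, tsum_fintype]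
    refine tendsto_finsetSum _ fun a _ => ENNReal.Tendsto.mul (hs a) (Or.inl one_ne_zero) (ih a) ?_
    exact Or.inr ENNReal.one_ne_top

/-- Limit and sum are exchanged by two bounds. Since `genProb ≤ 1`, each level-`n` sum is at most
the full sum, and so is the limit. Conversely, each finite partial sum is the limit of its level-`n`
versions, which are at most the whole level-`n` sums. -/
theorem tsum_class_eq {P : Finset ℕ} (hP : ∀ p ∈ P, p.Prime) {G : Type*} [AddCommGroup G]
    (hG : IsAbelianPGroup P G) (k : ℕ) :
    ∑' C : AbelianPClass P, (chainCount k C.rep.carrier : ℝ≥0∞) *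
        (autCount C.rep.carrier : ℝ≥0∞)⁻¹ * surCount C.rep.carrier G =
      ENNReal.ofReal (∏ p ∈ P, (qPochhammerInf (p : ℝ)⁻¹ (p : ℝ)⁻¹)⁻¹) ^ k * chainCount k G := by
  have := hG.1
  have hfin : ∀ C : AbelianPClass P, Finite C.rep.carrier :=
    fun C => C.rep.isAbelianPGroup.1
  have hlim : Filter.Tendsto (fun n => genProb n (⊤ : AddSubgroup G) *
      (subgroupZeta P n (Fin n → ℤ) ^ k * weightedChains (genProb n) k ⊥ (⊤ : AddSubgroup G)))
      Filter.atTop (nhds (1 * (ENNReal.ofReal (∏ p ∈ P,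
        (qPochhammerInf (p : ℝ)⁻¹ (p : ℝ)⁻¹)⁻¹) ^ k * chainCount k G))) := by
    have hw := tendsto_weightedChains (tendsto_genProb (G := G)) k ⊥ ⊤
    rw [← card_chains_eq_weightedChains] at hw
    have hz : ENNReal.ofReal (∏ p ∈ P, (qPochhammerInf (p : ℝ)⁻¹ (p : ℝ)⁻¹)⁻¹) ^ k ≠ ∞ :=
      ENNReal.pow_ne_top ENNReal.ofReal_ne_top
    exact ENNReal.Tendsto.mul (tendsto_genProb ⊤) (Or.inl one_ne_zero)
      (ENNReal.Tendsto.mul (ENNReal.Tendsto.pow (tendsto_subgroupZeta_int_pow hP))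
        (Or.inr (ENNReal.natCast_ne_top _)) hw (Or.inr hz))
      (Or.inr ENNReal.one_ne_top)
  rw [one_mul] at hlim
  simp only [← tsum_class_genProb hP hG] at hlim
  refine le_antisymm ?_ (le_of_tendsto' hlim fun n => ENNReal.tsum_le_tsum fun C =>
    mul_le_of_le_one_right' (genProb_le_one n _))
  rw [ENNReal.tsum_eq_iSup_sum]
  refine iSup_le fun t => ?_
  refine le_of_tendsto_of_tendsto' (tendsto_finsetSum t fun C _ => ?_) hlim
    fun n => ENNReal.sum_le_tsum t
  have ha : (autCount C.rep.carrier : ℝ≥0∞) ≠ 0 := by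
    exact_mod_cast (autCount_pos C.rep.carrier).ne'
  have h := ENNReal.Tendsto.const_mul
    (a := (chainCount k C.rep.carrier : ℝ≥0∞) *
      (autCount C.rep.carrier : ℝ≥0∞)⁻¹ * surCount C.rep.carrier G)
    (tendsto_genProb (⊤ : AddSubgroup C.rep.carrier))
    (Or.inl one_ne_zero)
  rwa [mul_one] at h

/-! ### The probability measure and its moments -/

theorem AbelianPClass.weight_eq {P : Finset ℕ} (k : ℕ) (C : AbelianPClass P) :
    C.weight k = prodWeight P k C.rep.carrier := by
  conv_lhs => rw [← C.mk_rep_eq]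
  rfl

theorem AbelianPClass.sur_eq {P : Finset ℕ} (G : Type*) [AddCommGroup G] (C : AbelianPClass P) :
    C.sur G = surCount C.rep.carrier G := by
  conv_lhs => rw [← C.mk_rep_eq]
  rfl

theorem AbelianPClass.weight_nonneg {P : Finset ℕ} (hP : ∀ p ∈ P, p.Prime) (k : ℕ)
    (C : AbelianPClass P) : 0 ≤ C.weight k := by
  rw [AbelianPClass.weight_eq, prodWeight]
  have : 0 ≤ ∏ p ∈ P, qPochhammerInf (p : ℝ)⁻¹ (p : ℝ)⁻¹ ^ k :=
    Finset.prod_nonneg fun p hp => pow_nonneg (qPochhammerInf_pos (hP p hp)).le k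
  positivity

theorem tsum_weight_mul_sur {P : Finset ℕ} (hP : ∀ p ∈ P, p.Prime) {G : Type*} [AddCommGroup G]
    (hG : IsAbelianPGroup P G) (k : ℕ) :
    ∑' C : AbelianPClass P, ENNReal.ofReal (C.weight k) * (C.sur G : ℝ≥0∞) = chainCount k G := by
  have hq : ∀ p ∈ P, 0 < qPochhammerInf (p : ℝ)⁻¹ (p : ℝ)⁻¹ := fun p hp =>
    qPochhammerInf_pos (hP p hp)
  have hpos : 0 < ∏ p ∈ P, qPochhammerInf (p : ℝ)⁻¹ (p : ℝ)⁻¹ := Finset.prod_pos hq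
  have hterm : ∀ C : AbelianPClass P, ENNReal.ofReal (C.weight k) * (C.sur G : ℝ≥0∞) =
      ENNReal.ofReal (∏ p ∈ P, qPochhammerInf (p : ℝ)⁻¹ (p : ℝ)⁻¹) ^ k *
        ((chainCount k C.rep.carrier : ℝ≥0∞) *
        (autCount C.rep.carrier : ℝ≥0∞)⁻¹ * surCount C.rep.carrier G) := by
    intro C
    have := C.rep.isAbelianPGroup.1
    have ha : (0 : ℝ) < autCount C.rep.carrier := by
      exact_mod_cast autCount_pos C.rep.carrier
    rw [AbelianPClass.weight_eq, AbelianPClass.sur_eq, prodWeight, Finset.prod_pow,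
      ENNReal.ofReal_div_of_pos ha, ENNReal.ofReal_mul (by positivity),
      ENNReal.ofReal_pow hpos.le, ENNReal.ofReal_natCast, ENNReal.ofReal_natCast, div_eq_mul_inv]
    ring
  rw [tsum_congr hterm, ENNReal.tsum_mul_left, tsum_class_eq hP hG, ← mul_assoc, ← mul_pow,
    ← ENNReal.ofReal_mul hpos.le, Finset.prod_inv_distrib, mul_inv_cancel₀ hpos.ne',
    ENNReal.ofReal_one, one_pow, one_mul]

theorem surCount_of_subsingleton (B G : Type*) [AddCommGroup B] [AddCommGroup G]
    [Subsingleton G] : surCount B G = 1 := by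
  rw [surCount, Nat.card_eq_one_iff_unique]
  have : Subsingleton (B →+ G) := ⟨fun f g => AddMonoidHom.ext fun _ => Subsingleton.elim _ _⟩
  exact ⟨inferInstance, ⟨⟨0, fun y => ⟨0, Subsingleton.elim _ _⟩⟩⟩⟩

theorem chainCount_of_subsingleton (k : ℕ) (G : Type*) [AddCommGroup G] [Subsingleton G] :
    chainCount k G = 1 := by
  rw [chainCount, Nat.card_eq_one_iff_unique]
  exact ⟨inferInstance, ⟨⟨fun _ => ⊥, monotone_const, rfl, Subsingleton.elim _ _⟩⟩⟩

/-- The moment formula for the trivial group, where `#Sur(B, 0) = 1` and `n_k(0) = 1`. -/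
theorem tsum_weight {P : Finset ℕ} (hP : ∀ p ∈ P, p.Prime) (k : ℕ) :
    ∑' C : AbelianPClass P, ENNReal.ofReal (C.weight k) = 1 := by
  have hG : IsAbelianPGroup P PUnit.{1} :=
    isAbelianPGroup_of_mem_factoredNumbers (by simpa using one_mem_factoredNumbers P)
  have h := tsum_weight_mul_sur hP hG k
  simpa [AbelianPClass.sur_eq, surCount_of_subsingleton, chainCount_of_subsingleton] using h

/-- Restricting to the support, which is countable for every `PMF`, avoids any countability
assumption on `α`. -/
theorem PMF.lintegral_eq_tsum {α : Type*} [MeasurableSpace α] [MeasurableSingletonClass α]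
    (p : PMF α) (f : α → ℝ≥0∞) : ∫⁻ a, f a ∂p.toMeasure = ∑' a, p a * f a := by
  rw [← p.restrict_toMeasure_support, lintegral_countable f p.support_countable,
    ← tsum_subtype_eq_of_support_subset (s := p.support)]
  · refine tsum_congr fun a => ?_
    rw [PMF.toMeasure_apply_singleton p a (MeasurableSet.singleton _), mul_comm]
  · intro a ha
    exact (p.mem_support_iff a).2 (left_ne_zero_of_mul ha)

theorem theorem7p2 (P : Finset ℕ) (hP : ∀ p ∈ P, p.Prime) (k : ℕ) (hk : 1 ≤ k) :
    ∃ μ : PMF (AbelianPClass P),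
      (∀ B : AbelianPClass P, (μ B).toReal = B.weight k) ∧
      ∀ (G : Type*) [AddCommGroup G], IsAbelianPGroup P G →
        Integrable (fun B : AbelianPClass P => (B.sur G : ℝ)) μ.toMeasure ∧
        ∫ B : AbelianPClass P, (B.sur G : ℝ) ∂μ.toMeasure = (chainCount k G : ℝ) := by
  have : MeasurableSingletonClass (AbelianPClass P) := ⟨fun _ => trivial⟩
  let μ : PMF (AbelianPClass P) :=
    ⟨fun B => ENNReal.ofReal (B.weight k), tsum_weight hP k ▸ ENNReal.summable.hasSum⟩
  refine ⟨μ, fun B => ENNReal.toReal_ofReal (B.weight_nonneg hP k), fun G _ hG => ?_⟩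
  have hmeas : AEStronglyMeasurable (fun B : AbelianPClass P => (B.sur G : ℝ)) μ.toMeasure :=
    (show Measurable (fun B : AbelianPClass P => (B.sur G : ℝ)) from
      fun _ _ => trivial).aestronglyMeasurable
  have hl : ∫⁻ B : AbelianPClass P, ENNReal.ofReal (B.sur G : ℝ) ∂μ.toMeasure = chainCount k G := by
    simp only [ENNReal.ofReal_natCast]
    rw [PMF.lintegral_eq_tsum]
    exact tsum_weight_mul_sur hP hG k
  have hnn : 0 ≤ᵐ[μ.toMeasure] fun B : AbelianPClass P => (B.sur G : ℝ) :=
    Filter.Eventually.of_forall fun B => Nat.cast_nonneg _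
  refine ⟨⟨hmeas, ?_⟩, ?_⟩
  · rw [hasFiniteIntegral_iff_ofReal hnn, hl]
    exact ENNReal.natCast_lt_top _
  · rw [integral_eq_lintegral_of_nonneg_ae hnn hmeas, hl, ENNReal.toReal_natCast]
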